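/- Let $\Gamma$ be a distance-regular graph with vertex set $X$, path-length distance $\partial$, diameter $D\ge 3$, intersection numbers $p^h_{i,j}$ $(0\le h,i,j\le D)$ and valencies $k_i=p^0_{i,i}$ $(0\le i\le D)$. Let $A_0,\dots,A_D\in{\rm Mat}_X(\mathbb C)$ be the distance matrices of $\Gamma$, let $A=A_1$, and let $E_0,\dots,E_D$ be an ordering of the primitive idempotents of the Bose-Mesner algebra ${\rm Span}\{A_0,\dots,A_D\}$, where $E_0=|X|^{-1}J$ and $J$ is the all-ones matrix. Define the matrices $P,Q\in {\rm Mat}_{D+1}(\mathbb C)$ by $A_j=\sum_{i=0}^D P_{i,j}E_i$ and $E_j=|X|^{-1}\sum_{i=0}^D Q_{i,j}A_i$ $(0\le j\le D)$. Assume that the ordering is formally self-dual, that is, $P=Q$, and that it has $q$-Racah type: there are $q,a,\alpha,\varepsilon\in\mathbb C$ with $q,a,\alpha$ nonzero and $q^2\neq\pm1$ such that $\theta_i:=P_{i,1}$ satisfies $$\theta_i=\alpha\bigl(a q^{2i-D}+a^{-1}q^{D-2i}\bigr)+\varepsilon\qquad(0\le i\le D).$$ (Since $P=Q$, the scalars $\theta^*_i:=Q_{i,1}$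 are given by the same formula.) Fix $x\in X$. For $0\le i\le D$ let $E^*_i\in{\rm Mat}_X(\mathbb C)$ be the diagonal matrix with $(y,y)$-entry $1$ if $\partial(x,y)=i$ and $0$ otherwise, and let $A^*\in{\rm Mat}_X(\mathbb C)$ be the diagonal matrix with $(y,y)$-entry $|X|(E_1)_{x,y}$. Assume that (the $Z$-assumption) $$\sum_{i=0}^D E^*_i\,\frac{A-\varepsilon I}{\alpha}\,E^*_i\Bigl(1+\frac{\theta_i-\varepsilon}{\alpha}\,\frac1{q+q^{-1}}\Bigr)=\sum_{i=0}^D E_i\,\frac{A^*-\varepsilon I}{\alpha}\,E_i\Bigl(1+\frac{\theta_i-\varepsilon}{\alpha}\,\frac1{q+q^{-1}}\Bigr).$$ Let $\tau_i=(-1)^i a^{-i}q^{i(D-i)}$ $(0\le i\le D)$. Then $$|X|=\Bigl(\sum_{i=0}^D\tau_i k_i\Bigr)\Bigl(\sum_{i=0}^D\tau_i^{-1}k_i\Bigr).$$ In particular $\sum_{i=0}^D\tau_i k_i\neq0$ and $\sum_{i=0}^D\tau_i^{-1}k_i\neq0$. -/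

import Mathlib

namespace DRG

variable {X : Type*} [Fintype X] [DecidableEq X]

/-- `G` is a distance-regular graph of diameter `D` with intersection numbers `p h i j`
(in print `p^h_{i,j}`): `G` is connected of diameter `D`, and for `0 ≤ h, i, j ≤ D` and all
vertices `y, z` at distance `h`, exactly `p h i j` vertices are at distance `i` from `y` and
at distance `j` from `z`. Values of `p` at indices above `D` are irrelevant. -/
structure IsDistanceRegular (G : SimpleGraph X) (D : ℕ) (p : ℕ → ℕ → ℕ → ℕ) : Prop where
  connected : G.Connected
  diam_eq : G.diam = D
  card_eq : ∀ h i j : ℕ, h ≤ D → i ≤ D → j ≤ D → ∀ y z : X, G.dist y z = h →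
    (Finset.univ.filter fun w : X => G.dist y w = i ∧ G.dist z w = j).card = p h i j

/-- The valency `k_i = p^0_{i,i}`. -/
def valency (p : ℕ → ℕ → ℕ → ℕ) (i : ℕ) : ℕ := p 0 i i

/-- The `i`th distance matrix `A_i`. -/
noncomputable def distMatrix (G : SimpleGraph X) (i : ℕ) : Matrix X X ℂ :=
  Matrix.of fun y z => if G.dist y z = i then 1 else 0

/-- The Bose-Mesner algebra `M`, as the span of `A_0, …, A_D`. -/
noncomputable def boseMesner (G : SimpleGraph X) (D : ℕ) : Submodule ℂ (Matrix X X ℂ) :=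
  Submodule.span ℂ (Set.range fun i : Fin (D + 1) => distMatrix G i)

/-- `E_0, …, E_D` is an ordering of the primitive idempotents of `G`, with the convention
`E_0 = |X|⁻¹ J`. -/
structure IsPrimitiveIdempotents (G : SimpleGraph X) (D : ℕ)
    (E : Fin (D + 1) → Matrix X X ℂ) : Prop where
  linearIndependent : LinearIndependent ℂ E
  span_eq : Submodule.span ℂ (Set.range E) = boseMesner G D
  zero_eq : E 0 = (Fintype.card X : ℂ)⁻¹ • Matrix.of fun _ _ => (1 : ℂ)
  sum_eq : ∑ i, E i = 1
  transpose_eq : ∀ i, (E i).transpose = E i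
  conj_eq : ∀ i, (E i).map (starRingEnd ℂ) = E i
  mul_eq : ∀ i j, E i * E j = if i = j then E i else 0

/-- `P` is the first eigenmatrix: `A_j = ∑ i, P_{i,j} E_i`. -/
def IsFirstEigenmatrix (G : SimpleGraph X) {D : ℕ} (E : Fin (D + 1) → Matrix X X ℂ)
    (P : Matrix (Fin (D + 1)) (Fin (D + 1)) ℂ) : Prop :=
  ∀ j : Fin (D + 1), distMatrix G j = ∑ i, P i j • E i

/-- `Q` is the second eigenmatrix: `E_j = |X|⁻¹ ∑ i, Q_{i,j} A_i`. -/
def IsSecondEigenmatrix (G : SimpleGraph X) {D : ℕ} (E : Fin (D + 1) → Matrix X X ℂ)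
    (Q : Matrix (Fin (D + 1)) (Fin (D + 1)) ℂ) : Prop :=
  ∀ j : Fin (D + 1),
    E j = (Fintype.card X : ℂ)⁻¹ • ∑ i : Fin (D + 1), Q i j • distMatrix G i

/-- The `i`th dual primitive idempotent `E*_i(x)` with respect to the base vertex `x`. -/
noncomputable def dualIdempotent (G : SimpleGraph X) (x : X) (i : ℕ) : Matrix X X ℂ :=
  Matrix.diagonal fun y => if G.dist x y = i then 1 else 0

/-- The dual adjacency matrix `A*(x) = A*_1(x)`, diagonal with `(y,y)`-entry `|X| (E_1)_{x,y}`. -/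
def dualAdjMatrix {D : ℕ} (E : Fin (D + 1) → Matrix X X ℂ) (x : X) : Matrix X X ℂ :=
  Matrix.diagonal fun y => (Fintype.card X : ℂ) * E 1 x y

/-- The `Z`-assumption at the base vertex `x`, for the eigenvalues `θ_0, …, θ_D` and the
scalars `q, α, ε`; the adjacency matrix `A` is the distance matrix `A_1`. -/
def ZAssumption (G : SimpleGraph X) {D : ℕ} (E : Fin (D + 1) → Matrix X X ℂ)
    (θ : Fin (D + 1) → ℂ) (q α ε : ℂ) (x : X) : Prop :=
  ∑ i : Fin (D + 1), (1 + (θ i - ε) / α * (1 / (q + q⁻¹))) •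
      (dualIdempotent G x i * (α⁻¹ • (distMatrix G 1 - ε • 1)) * dualIdempotent G x i) =
    ∑ i : Fin (D + 1), (1 + (θ i - ε) / α * (1 / (q + q⁻¹))) •
      (E i * (α⁻¹ • (dualAdjMatrix E x - ε • 1)) * E i)

/-- The scalars `τ_i = (-1)^i a^{-i} q^{i(D-i)}`. -/
noncomputable def tau (D : ℕ) (a q : ℂ) (i : ℕ) : ℂ :=
  (-1) ^ i * a ^ (-(i : ℤ)) * q ^ ((i : ℤ) * ((D : ℤ) - (i : ℤ)))

end DRG

open Matrix

/-! On the span of the spheres around `x`, the matrix `A` acts as the intersection matrix `M` and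
`A*` as `Θ = diag(θ_i)`. The columns of `P = Q` are eigenvectors of `M`, so `M P = P Θ`. Also `P² =
|X| I`, hence `Θ P = P M`: conjugation by `P` swaps `M` and `Θ`.

Normalize to `α = 1`, `ε = 0`, let `N` be the normalized `M` and `T = diag(τ_i)`. Restricted to this
span, the Z-assumption makes `N_ii (1 + θ_i/(q+q⁻¹))` a constant `f`
(`sphereMatrix_diag_of_ZAssumption`). With this, `T⁻¹ N T` and `T N T⁻¹` equal `f I` minus multiples
of the two q-commutators of `N` and `Θ`. These are exchanged by `P`, so `T⁻¹ N T P = P T N T⁻¹`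
(`mul_conj_tau_eq`).

Apply this to the vector `τ`: since `T⁻¹ τ` is constant and `N` has constant row sums, `T P τ` is an
eigenvector of `N` for the row sum, hence constant. So `P τ = s τ⁻¹` (`exists_mulVec_tau_eq`). Row 0
of `P` lists the valencies, so `s = ∑ τ_i k_i`; a second application of `P` gives `|X| = s ∑ τ_i⁻¹
k_i`. -/

namespace DRG

/-! ### Matrix identities for `q`-Racah eigenvalues and the scalars `τ_i`. -/

section LinearAlgebra

variable {D : ℕ}

/-- A tridiagonal matrix with constant row sums and nonvanishing superdiagonal has only the
constant vectors as eigenvectors for the row sum. -/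
theorem eq_const_of_tridiagonal_mulVec {M : Matrix (Fin (D + 1)) (Fin (D + 1)) ℂ} {t : ℂ}
    (htri : ∀ i j : Fin (D + 1), M i j ≠ 0 → (i : ℕ) ≤ j + 1 ∧ (j : ℕ) ≤ i + 1)
    (hsup : ∀ i j : Fin (D + 1), (j : ℕ) = i + 1 → M i j ≠ 0)
    (hrow : ∀ i, ∑ j, M i j = t) {v : Fin (D + 1) → ℂ} (hv : M *ᵥ v = t • v)
    (i : Fin (D + 1)) : v i = v 0 := by
  obtain ⟨n, hn⟩ := i
  induction n using Nat.strong_induction_on with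
  | _ n ih =>
    rcases n with _ | n
    · rfl
    · have hn' : n < D + 1 := by omega
      -- By induction every term of this row vanishes except possibly the one at `n + 1`.
      have h0 : ∑ j, M ⟨n, hn'⟩ j * (v j - v 0) = 0 := by
        have h := congrFun hv ⟨n, hn'⟩
        simp only [mulVec, dotProduct, Pi.smul_apply, smul_eq_mul] at h
        simp only [mul_sub, Finset.sum_sub_distrib, ← Finset.sum_mul, hrow, h]
        rw [ih n (by omega) hn', sub_self]
      rw [Finset.sum_eq_single (⟨n + 1, hn⟩ : Fin (D + 1))] at h0
      · exact sub_eq_zero.1 ((mul_eq_zero.1 h0).resolve_left (hsup _ _ rfl))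
      · rintro ⟨j, hj⟩ - hne
        by_cases hM : M ⟨n, hn'⟩ ⟨j, hj⟩ = 0
        · rw [hM, zero_mul]
        · have h1 := (htri _ _ hM).2
          have h2 : j ≠ n + 1 := fun h => hne (Fin.ext h)
          simp only at h1
          rw [ih j (by omega) hj, sub_self, mul_zero]
      · intro h
        exact absurd (Finset.mem_univ _) h

theorem tau_ne_zero {a q : ℂ} (ha : a ≠ 0) (hq : q ≠ 0) (i : ℕ) : tau D a q i ≠ 0 := by
  unfold tau
  exact mul_ne_zero (mul_ne_zero (pow_ne_zero _ (by norm_num)) (zpow_ne_zero _ ha))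
    (zpow_ne_zero _ hq)

theorem tau_zero (a q : ℂ) : tau D a q 0 = 1 := by
  simp [tau]

theorem tau_succ {a q : ℂ} (ha : a ≠ 0) (hq : q ≠ 0) (i : ℕ) :
    tau D a q (i + 1) = -(a⁻¹ * q ^ ((D : ℤ) - 2 * i - 1)) * tau D a q i := by
  have h1 : a ^ (-((i + 1 : ℕ) : ℤ)) = a ^ (-(i : ℤ)) * a⁻¹ := by
    rw [← zpow_neg_one a, ← zpow_add₀ ha]
    congr 1
    push_cast
    ring
  have h2 : q ^ (((i + 1 : ℕ) : ℤ) * ((D : ℤ) - ((i + 1 : ℕ) : ℤ))) =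
      q ^ ((i : ℤ) * ((D : ℤ) - i)) * q ^ ((D : ℤ) - 2 * i - 1) := by
    rw [← zpow_add₀ hq]
    congr 1
    push_cast
    ring
  unfold tau
  rw [h1, h2, pow_succ]
  ring

/-- Since `P²` is a nonzero scalar, conjugation by `P` is an involution. -/
theorem mul_eq_mul_of_mul_self_eq_smul_one {P M Θ : Matrix (Fin (D + 1)) (Fin (D + 1)) ℂ} {c : ℂ}
    (hc : c ≠ 0) (hP : P * P = c • 1) (h : M * P = P * Θ) : Θ * P = P * M := by
  refine smul_right_injective _ hc ?_
  calc c • (Θ * P) = P * P * (Θ * P) := by rw [hP, Matrix.smul_mul, Matrix.one_mul]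
    _ = P * (P * Θ) * P := by simp only [Matrix.mul_assoc]
    _ = P * M * (P * P) := by rw [← h]; simp only [Matrix.mul_assoc]
    _ = c • (P * M) := by rw [hP, Matrix.mul_smul, Matrix.mul_one]

/-- The `q`-Racah eigenvalues, normalized so that `α = 1` and `ε = 0`. -/
noncomputable def racahEigenvalue (D : ℕ) (a q : ℂ) (i : ℕ) : ℂ :=
  a * q ^ (2 * (i : ℤ) - (D : ℤ)) + a⁻¹ * q ^ ((D : ℤ) - 2 * (i : ℤ))

/-- The weights `q`, `q⁻¹` cancel one of the two geometric terms; what survives is, up to the factor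
`-(q² - q⁻²)`, the ratio `τ_i / τ_{i+1}`. The companion `racahEigenvalue_down` yields the inverse
ratio. -/
theorem racahEigenvalue_up {a q : ℂ} (hq : q ≠ 0) (i : ℕ) :
    q * racahEigenvalue D a q (i + 1) - q⁻¹ * racahEigenvalue D a q i =
      (q ^ 2 - (q ^ 2)⁻¹) * (a * q ^ (2 * (i : ℤ) + 1 - D)) := by
  have h1 : q ^ (2 * ((i + 1 : ℕ) : ℤ) - (D : ℤ)) = q ^ (2 * (i : ℤ) - D) * q ^ 2 := by
    rw [← zpow_natCast q 2, ← zpow_add₀ hq]; congr 1; push_cast; ring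
  have h2 : q ^ ((D : ℤ) - 2 * (i : ℤ)) = q ^ ((D : ℤ) - 2 * ((i + 1 : ℕ) : ℤ)) * q ^ 2 := by
    rw [← zpow_natCast q 2, ← zpow_add₀ hq]; congr 1; push_cast; ring
  have h3 : q ^ (2 * (i : ℤ) + 1 - D) = q ^ (2 * (i : ℤ) - D) * q := by
    rw [← zpow_add_one₀ hq]; congr 1; ring
  unfold racahEigenvalue
  rw [h1, h2, h3]
  generalize a⁻¹ = b
  field_simp
  ring

theorem racahEigenvalue_down {a q : ℂ} (hq : q ≠ 0) (i : ℕ) :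
    q * racahEigenvalue D a q i - q⁻¹ * racahEigenvalue D a q (i + 1) =
      (q ^ 2 - (q ^ 2)⁻¹) * (a⁻¹ * q ^ ((D : ℤ) - 2 * i - 1)) := by
  have h1 : q ^ (2 * ((i + 1 : ℕ) : ℤ) - (D : ℤ)) = q ^ (2 * (i : ℤ) - D) * q ^ 2 := by
    rw [← zpow_natCast q 2, ← zpow_add₀ hq]; congr 1; push_cast; ring
  have h2 : q ^ ((D : ℤ) - 2 * (i : ℤ)) = q ^ ((D : ℤ) - 2 * ((i + 1 : ℕ) : ℤ)) * q ^ 2 := by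
    rw [← zpow_natCast q 2, ← zpow_add₀ hq]; congr 1; push_cast; ring
  have h3 : q ^ ((D : ℤ) - 2 * i - 1) = q ^ ((D : ℤ) - 2 * ((i + 1 : ℕ) : ℤ)) * q := by
    rw [← zpow_add_one₀ hq]; congr 1; push_cast; ring
  unfold racahEigenvalue
  rw [h1, h2, h3]
  generalize a⁻¹ = b
  field_simp
  ring

/-- Conjugating a tridiagonal matrix by `diag(τ_i)` amounts to a `q`-commutator with the
diagonal matrix of `q`-Racah eigenvalues. -/
theorem mul_tau_div_tau {a q f : ℂ} (ha : a ≠ 0) (hq : q ≠ 0) (hq1 : q ^ 2 ≠ 1)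
    (hq2 : q ^ 2 ≠ -1) {M : Matrix (Fin (D + 1)) (Fin (D + 1)) ℂ}
    (htri : ∀ i j : Fin (D + 1), i ≠ j → M i j ≠ 0 → (i : ℕ) ≤ j + 1 ∧ (j : ℕ) ≤ i + 1)
    (hf : ∀ i : Fin (D + 1), (1 + racahEigenvalue D a q i * (1 / (q + q⁻¹))) * M i i = f)
    (i j : Fin (D + 1)) :
    (tau D a q i)⁻¹ * M i j * tau D a q j = f * (1 : Matrix _ _ ℂ) i j -
      (q ^ 2 - (q ^ 2)⁻¹)⁻¹ *
        ((q * racahEigenvalue D a q i - q⁻¹ * racahEigenvalue D a q j) * M i j) := by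
  have hp : q ^ 2 + 1 ≠ 0 := fun h => hq2 (eq_neg_of_add_eq_zero_left h)
  have hm : q ^ 2 - 1 ≠ 0 := sub_ne_zero.2 hq1
  have hs : q + q⁻¹ ≠ 0 := by
    have : q + q⁻¹ = (q ^ 2 + 1) / q := by field_simp
    rw [this]; exact div_ne_zero hp hq
  have hd : q ^ 2 - (q ^ 2)⁻¹ = (q - q⁻¹) * (q + q⁻¹) := by
    field_simp
    ring
  have hdm : q - q⁻¹ ≠ 0 := by
    have : q - q⁻¹ = (q ^ 2 - 1) / q := by field_simp
    rw [this]; exact div_ne_zero hm hq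
  have hd0 : q ^ 2 - (q ^ 2)⁻¹ ≠ 0 := hd ▸ mul_ne_zero hdm hs
  by_cases hij : i = j
  · subst hij
    -- On the diagonal the q-commutator contributes `θ_i M_ii / (q + q⁻¹)`, exactly the excess of
    -- `f` over `M_ii`.
    rw [one_apply_eq, ← hf i, ← sub_mul, hd]
    have := tau_ne_zero (D := D) ha hq i
    field_simp
    ring
  rw [one_apply_ne hij, mul_zero, zero_sub]
  by_cases hM : M i j = 0
  · simp [hM]
  obtain ⟨h1, h2⟩ := htri i j hij hM
  have h3 : (i : ℕ) ≠ j := fun h => hij (Fin.ext h)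
  rcases (by omega : (j : ℕ) = i + 1 ∨ (i : ℕ) = j + 1) with h | h
  · rw [h, tau_succ ha hq, racahEigenvalue_down hq]
    have := tau_ne_zero (D := D) ha hq i
    rw [mul_assoc (q ^ 2 - (q ^ 2)⁻¹), inv_mul_cancel_left₀ hd0]
    field_simp
  · rw [h, tau_succ ha hq, racahEigenvalue_up hq, mul_assoc (q ^ 2 - (q ^ 2)⁻¹),
      inv_mul_cancel_left₀ hd0]
    have := tau_ne_zero (D := D) ha hq j
    have h5 : q ^ (2 * (j : ℤ) + 1 - D) = (q ^ ((D : ℤ) - 2 * j - 1))⁻¹ := by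
      rw [← _root_.zpow_neg]; congr 1; ring
    rw [h5]
    have h6 := zpow_ne_zero ((D : ℤ) - 2 * j - 1) hq
    generalize q ^ ((D : ℤ) - 2 * j - 1) = w at *
    field_simp

theorem tau_div_tau_mul {a q f : ℂ} (ha : a ≠ 0) (hq : q ≠ 0) (hq1 : q ^ 2 ≠ 1)
    (hq2 : q ^ 2 ≠ -1) {M : Matrix (Fin (D + 1)) (Fin (D + 1)) ℂ}
    (htri : ∀ i j : Fin (D + 1), i ≠ j → M i j ≠ 0 → (i : ℕ) ≤ j + 1 ∧ (j : ℕ) ≤ i + 1)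
    (hf : ∀ i : Fin (D + 1), (1 + racahEigenvalue D a q i * (1 / (q + q⁻¹))) * M i i = f)
    (i j : Fin (D + 1)) :
    tau D a q i * M i j * (tau D a q j)⁻¹ = f * (1 : Matrix _ _ ℂ) i j -
      (q ^ 2 - (q ^ 2)⁻¹)⁻¹ *
        ((q * racahEigenvalue D a q j - q⁻¹ * racahEigenvalue D a q i) * M i j) := by
  have h := mul_tau_div_tau (M := Mᵀ) ha hq hq1 hq2
    (fun i j hij hM => (htri j i hij.symm hM).symm) hf j i
  have h1 : (1 : Matrix (Fin (D + 1)) (Fin (D + 1)) ℂ) j i = (1 : Matrix _ _ ℂ) i j := by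
    simp [one_apply, eq_comm]
  rw [transpose_apply, h1] at h
  rw [← h]
  ring

theorem mul_conj_tau_eq {a q f : ℂ} (ha : a ≠ 0) (hq : q ≠ 0) (hq1 : q ^ 2 ≠ 1)
    (hq2 : q ^ 2 ≠ -1) {M P : Matrix (Fin (D + 1)) (Fin (D + 1)) ℂ}
    (htri : ∀ i j : Fin (D + 1), i ≠ j → M i j ≠ 0 → (i : ℕ) ≤ j + 1 ∧ (j : ℕ) ≤ i + 1)
    (hf : ∀ i : Fin (D + 1), (1 + racahEigenvalue D a q i * (1 / (q + q⁻¹))) * M i i = f)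
    (h1 : M * P = P * diagonal fun i : Fin (D + 1) => racahEigenvalue D a q i)
    (h2 : (diagonal fun i : Fin (D + 1) => racahEigenvalue D a q i) * P = P * M) :
    (diagonal (fun i : Fin (D + 1) => (tau D a q i)⁻¹) * M *
        diagonal (fun i : Fin (D + 1) => tau D a q i)) * P =
      P * (diagonal (fun i : Fin (D + 1) => tau D a q i) * M *
        diagonal (fun i : Fin (D + 1) => (tau D a q i)⁻¹)) := by
  set Θ := diagonal fun i : Fin (D + 1) => racahEigenvalue D a q i with hΘ
  have e1 : diagonal (fun i : Fin (D + 1) => (tau D a q i)⁻¹) * M *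
      diagonal (fun i : Fin (D + 1) => tau D a q i) =
      f • 1 - (q ^ 2 - (q ^ 2)⁻¹)⁻¹ • (q • (Θ * M) - q⁻¹ • (M * Θ)) := by
    ext i j
    have := mul_tau_div_tau ha hq hq1 hq2 htri hf i j
    simp only [hΘ, diagonal_mul, mul_diagonal, Matrix.sub_apply, Matrix.smul_apply, smul_eq_mul, this]
    ring
  have e2 : diagonal (fun i : Fin (D + 1) => tau D a q i) * M *
      diagonal (fun i : Fin (D + 1) => (tau D a q i)⁻¹) =
      f • 1 - (q ^ 2 - (q ^ 2)⁻¹)⁻¹ • (q • (M * Θ) - q⁻¹ • (Θ * M)) := by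
    ext i j
    have := tau_div_tau_mul ha hq hq1 hq2 htri hf i j
    simp only [hΘ, diagonal_mul, mul_diagonal, Matrix.sub_apply, Matrix.smul_apply, smul_eq_mul, this]
    ring
  have e3 : Θ * M * P = P * (M * Θ) := by
    rw [Matrix.mul_assoc, h1, ← Matrix.mul_assoc, h2, Matrix.mul_assoc]
  have e4 : M * Θ * P = P * (Θ * M) := by
    rw [Matrix.mul_assoc, h2, ← Matrix.mul_assoc, h1, Matrix.mul_assoc]
  rw [e1, e2]
  simp only [Matrix.sub_mul, Matrix.mul_sub, Matrix.smul_mul, Matrix.mul_smul, Matrix.one_mul,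
    Matrix.mul_one, e3, e4]

/-- The eigenmatrix sends `τ` to a multiple of its entrywise inverse. -/
theorem exists_mulVec_tau_eq {a q f t : ℂ} (ha : a ≠ 0) (hq : q ≠ 0) (hq1 : q ^ 2 ≠ 1)
    (hq2 : q ^ 2 ≠ -1) {M P : Matrix (Fin (D + 1)) (Fin (D + 1)) ℂ} {α ε : ℂ} (hα : α ≠ 0)
    (htri : ∀ i j : Fin (D + 1), M i j ≠ 0 → (i : ℕ) ≤ j + 1 ∧ (j : ℕ) ≤ i + 1)
    (hsup : ∀ i j : Fin (D + 1), (j : ℕ) = i + 1 → M i j ≠ 0)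
    (hrow : ∀ i, ∑ j, M i j = t)
    (hf : ∀ i : Fin (D + 1), (1 + racahEigenvalue D a q i * (1 / (q + q⁻¹))) * (α⁻¹ • (M - ε • 1)) i i = f)
    (h1 : α⁻¹ • (M - ε • 1) * P =
      P * diagonal fun i : Fin (D + 1) => racahEigenvalue D a q i)
    (h2 : (diagonal fun i : Fin (D + 1) => racahEigenvalue D a q i) * P =
      P * α⁻¹ • (M - ε • 1)) :
    ∃ s : ℂ, ∀ i, (P *ᵥ fun j : Fin (D + 1) => tau D a q j) i = s * (tau D a q i)⁻¹ := by
  set N := α⁻¹ • (M - ε • 1) with hN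
  have hτ := tau_ne_zero (D := D) ha hq
  have hNM : M = α • N + ε • 1 := by
    rw [hN, smul_smul, mul_inv_cancel₀ hα, one_smul, sub_add_cancel]
  have htri' : ∀ i j : Fin (D + 1), i ≠ j → N i j ≠ 0 → (i : ℕ) ≤ j + 1 ∧ (j : ℕ) ≤ i + 1 := by
    intro i j hij h
    refine htri i j fun h0 => h ?_
    simp [hN, h0, one_apply_ne hij]
  have hc := mul_conj_tau_eq ha hq hq1 hq2 htri' hf h1 h2
  have hN1 : N *ᵥ (fun _ => 1) = fun _ => α⁻¹ * (t - ε) := by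
    ext i
    simp only [hN, smul_mulVec, sub_mulVec, one_mulVec, Pi.smul_apply, Pi.sub_apply, smul_eq_mul,
      mul_one]
    rw [← hrow i]
    simp [mulVec, dotProduct]
  set τ : Fin (D + 1) → ℂ := fun j => tau D a q j with hτd
  -- Constancy of `v` is equivalent to `P τ` being proportional to `τ⁻¹`.
  set v := diagonal τ *ᵥ (P *ᵥ τ) with hv
  have hNv : N *ᵥ v = (α⁻¹ * (t - ε)) • v := by
    have hTT : diagonal τ * diagonal (fun i : Fin (D + 1) => (tau D a q i)⁻¹) = 1 := by
      rw [diagonal_mul_diagonal, ← diagonal_one]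
      congr 1; ext i; exact mul_inv_cancel₀ (hτ i)
    have hw : diagonal (fun i : Fin (D + 1) => (tau D a q i)⁻¹) *ᵥ τ = fun _ => 1 := by
      ext i; rw [mulVec_diagonal]; exact inv_mul_cancel₀ (hτ i)
    have h := congrArg (fun A => diagonal τ *ᵥ (A *ᵥ τ)) hc
    simp only [← mulVec_mulVec] at h
    rw [mulVec_mulVec _ (diagonal τ) (diagonal _), hTT, one_mulVec, hw, hN1] at h
    rw [hv, h]
    have : (diagonal τ *ᵥ fun _ => α⁻¹ * (t - ε)) = (α⁻¹ * (t - ε)) • τ := by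
      ext i; rw [mulVec_diagonal]; simp [mul_comm]
    rw [this, mulVec_smul, mulVec_smul]
  have hMv : M *ᵥ v = t • v := by
    rw [congrArg (· *ᵥ v) hNM]
    simp only [add_mulVec, smul_mulVec, smul_mulVec, one_mulVec, hNv, smul_smul,
      ← add_smul]
    congr 1
    field_simp
    ring
  refine ⟨v 0, fun i => ?_⟩
  rw [← eq_const_of_tridiagonal_mulVec htri hsup hrow hMv i, hv, mulVec_diagonal]
  rw [mul_comm, inv_mul_cancel_left₀ (hτ i)]

end LinearAlgebra

/-! ### Passing between vertices and spheres. -/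

section Incidence

variable {X : Type*} {D : ℕ}

/-- The incidence matrix between vertices and the fibres of `r`. -/
def incidence (r : X → Fin (D + 1)) : Matrix X (Fin (D + 1)) ℂ :=
  Matrix.of fun y i => if r y = i then 1 else 0

theorem incidence_mul_apply {κ : Type*} (r : X → Fin (D + 1)) (N : Matrix (Fin (D + 1)) κ ℂ)
    (y : X) (k : κ) : (incidence r * N) y k = N (r y) k := by
  simp [incidence, mul_apply]

theorem incidence_mul_cancel {r : X → Fin (D + 1)} (hr : Function.Surjective r)
    {κ : Type*} {M N : Matrix (Fin (D + 1)) κ ℂ} (h : incidence r * M = incidence r * N) :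
    M = N := by
  ext i k
  obtain ⟨y, rfl⟩ := hr i
  simpa only [incidence_mul_apply] using congrFun (congrFun h y) k

end Incidence

/-! ### The primary module of a distance-regular graph. -/

section Graph

variable {X : Type*} [Fintype X] {G : SimpleGraph X} {D : ℕ}
  {p : ℕ → ℕ → ℕ → ℕ} {E : Fin (D + 1) → Matrix X X ℂ}
  {P Q : Matrix (Fin (D + 1)) (Fin (D + 1)) ℂ}

theorem IsDistanceRegular.dist_le (hG : IsDistanceRegular G D p) (y z : X) : G.dist y z ≤ D := by
  have := hG.connected.nonempty
  rw [← hG.diam_eq]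
  exact SimpleGraph.dist_le_diam (SimpleGraph.connected_iff_ediam_ne_top.1 hG.connected)

theorem IsDistanceRegular.card_ne_zero (hG : IsDistanceRegular G D p) :
    (Fintype.card X : ℂ) ≠ 0 := by
  have := hG.connected.nonempty
  exact_mod_cast Fintype.card_ne_zero

/-- The adjacency matrix in the basis of spheres around a vertex. -/
def sphereMatrix (D : ℕ) (p : ℕ → ℕ → ℕ → ℕ) : Matrix (Fin (D + 1)) (Fin (D + 1)) ℂ :=
  Matrix.of fun i j => (p i j 1 : ℂ)

theorem sphereMatrix_tridiagonal (hG : IsDistanceRegular G D p) (hD : 1 ≤ D) {x : X}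
    (hx : ∀ i : Fin (D + 1), ∃ y, G.dist x y = i) (i j : Fin (D + 1))
    (h : sphereMatrix D p i j ≠ 0) : (i : ℕ) ≤ j + 1 ∧ (j : ℕ) ≤ i + 1 := by
  obtain ⟨y, hy⟩ := hx i
  have hc := hG.card_eq i j 1 (by omega) (by omega) hD x y hy
  have hne : p i j 1 ≠ 0 := fun h0 => h (by simp [sphereMatrix, h0])
  rw [← hc, Finset.card_ne_zero] at hne
  obtain ⟨w, hw⟩ := hne
  simp only [Finset.mem_filter, Finset.mem_univ, true_and] at hw
  have h1 := hG.connected.dist_triangle (u := x) (v := w) (w := y)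
  have h2 := hG.connected.dist_triangle (u := x) (v := y) (w := w)
  rw [G.dist_comm (u := w)] at h1
  omega

theorem sphereMatrix_superdiagonal_ne_zero (hG : IsDistanceRegular G D p) (hD : 1 ≤ D) {x : X}
    (hx : ∀ i : Fin (D + 1), ∃ y, G.dist x y = i) (i j : Fin (D + 1))
    (hij : (j : ℕ) = i + 1) : sphereMatrix D p i j ≠ 0 := by
  obtain ⟨y, hy⟩ := hx j
  obtain ⟨w, hwy, hw⟩ : ∃ w, G.Adj w y ∧ G.dist x w = i := by
    obtain ⟨W, hW⟩ := hG.connected.exists_walk_length_eq_dist y x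
    cases W with
    | nil => simp at hW hy; omega
    | @cons _ w _ hadj W' =>
      refine ⟨w, hadj.symm, ?_⟩
      rw [SimpleGraph.Walk.length_cons, G.dist_comm, hy] at hW
      have h1 := SimpleGraph.dist_le W'
      have h2 := hG.connected.dist_triangle (u := x) (v := w) (w := y)
      rw [SimpleGraph.dist_eq_one_iff_adj.2 hadj.symm] at h2
      rw [G.dist_comm] at h1
      omega
  have hc := hG.card_eq i j 1 (by omega) (by omega) hD x w hw
  simp only [sphereMatrix, of_apply]
  rw [← hc, Nat.cast_ne_zero, Finset.card_ne_zero]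
  exact ⟨y, by simp [hy, SimpleGraph.dist_eq_one_iff_adj.2 hwy]⟩

theorem distMatrix_one_mul_incidence (hG : IsDistanceRegular G D p) (hD : 1 ≤ D) {x : X}
    {r : X → Fin (D + 1)} (hr : ∀ y, (r y : ℕ) = G.dist x y) :
    distMatrix G 1 * incidence r = incidence r * sphereMatrix D p := by
  ext y j
  rw [incidence_mul_apply, sphereMatrix, of_apply,
    ← hG.card_eq (r y) j 1 (by omega) (by omega) hD x y (hr y).symm]
  simp only [mul_apply, distMatrix, incidence, of_apply, Fin.ext_iff, hr, mul_ite, mul_one,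
    mul_zero, Finset.card_filter, Nat.cast_sum, Nat.cast_ite, Nat.cast_one, Nat.cast_zero]
  refine Finset.sum_congr rfl fun z _ => ?_
  split_ifs <;> simp_all

/-- In the basis of spheres around `x`, the columns of `Q` are the columns of `|X| E_j` at `x`. -/
theorem incidence_mul_secondEigenmatrix_apply (hG : IsDistanceRegular G D p)
    (hQ : IsSecondEigenmatrix G E Q) {x : X}
    {r : X → Fin (D + 1)} (hr : ∀ y, (r y : ℕ) = G.dist x y) (y : X) (j : Fin (D + 1)) :
    (incidence r * Q) y j = (Fintype.card X : ℂ) * E j y x := by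
  have hX := hG.card_ne_zero
  rw [incidence_mul_apply, hQ j, Matrix.smul_apply, smul_eq_mul, mul_inv_cancel_left₀ hX, Matrix.sum_apply]
  rw [Finset.sum_eq_single (r y)]
  · simp [distMatrix, hr, G.dist_comm]
  · intro b _ hb
    have : G.dist y x ≠ b := fun h => hb (Fin.ext (by rw [hr, G.dist_comm, h]))
    simp [distMatrix, this]
  · simp

variable [DecidableEq X]

/-- Expanding `E_j` in the `A_i` and back yields `P Q = |X| I`. -/
theorem firstEigenmatrix_mul_secondEigenmatrix (hG : IsDistanceRegular G D p)
    (hE : IsPrimitiveIdempotents G D E) (hP : IsFirstEigenmatrix G E P)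
    (hQ : IsSecondEigenmatrix G E Q) : P * Q = (Fintype.card X : ℂ) • 1 := by
  have hX := hG.card_ne_zero
  ext l j
  have h1 : ∑ l, (P * Q) l j • E l = ∑ l, ((Fintype.card X : ℂ) • (1 : Matrix _ _ ℂ)) l j • E l := by
    have h := congrArg (fun A => (Fintype.card X : ℂ) • A) (hQ j)
    simp only [smul_smul, mul_inv_cancel₀ hX, one_smul] at h
    have hr : ∑ l, ((Fintype.card X : ℂ) • (1 : Matrix _ _ ℂ)) l j • E l =
        (Fintype.card X : ℂ) • E j := by
      rw [Finset.sum_eq_single j]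
      · simp
      · intro b _ hb
        simp [one_apply_ne hb]
      · simp
    rw [hr, h]
    simp only [mul_apply, Finset.sum_smul]
    rw [Finset.sum_comm]
    refine Finset.sum_congr rfl fun i _ => ?_
    rw [hP i, Finset.smul_sum]
    refine Finset.sum_congr rfl fun l _ => ?_
    rw [smul_smul, mul_comm]
  have h2 := Fintype.linearIndependent_iff.1 hE.linearIndependent
    (fun l => (P * Q) l j - ((Fintype.card X : ℂ) • (1 : Matrix _ _ ℂ)) l j)
    (by simp only [sub_smul, Finset.sum_sub_distrib, h1, sub_self]) l
  exact sub_eq_zero.1 h2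

theorem firstEigenmatrix_zero_right (hG : IsDistanceRegular G D p)
    (hE : IsPrimitiveIdempotents G D E) (hP : IsFirstEigenmatrix G E P) (i : Fin (D + 1)) :
    P i 0 = 1 := by
  have h0 : distMatrix G ((0 : Fin (D + 1)) : ℕ) = 1 := by
    ext y z
    simp [distMatrix, one_apply, hG.connected.dist_eq_zero_iff]
  have h := hP 0
  rw [h0, ← hE.sum_eq] at h
  have h2 := Fintype.linearIndependent_iff.1 hE.linearIndependent (fun l => P l 0 - 1)
    (by simp only [sub_smul, Finset.sum_sub_distrib, ← h, one_smul, sub_self]) i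
  exact sub_eq_zero.1 h2

theorem distMatrix_mul_idempotent (hE : IsPrimitiveIdempotents G D E)
    (hP : IsFirstEigenmatrix G E P) (i j : Fin (D + 1)) :
    distMatrix G i * E j = P j i • E j := by
  rw [hP i, Matrix.sum_mul, Finset.sum_eq_single j]
  · rw [Matrix.smul_mul, hE.mul_eq, if_pos rfl]
  · intro b _ hb
    rw [Matrix.smul_mul, hE.mul_eq, if_neg hb, smul_zero]
  · simp

theorem firstEigenmatrix_zero_left (hG : IsDistanceRegular G D p)
    (hE : IsPrimitiveIdempotents G D E) (hP : IsFirstEigenmatrix G E P) (x : X)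
    (i : Fin (D + 1)) : P 0 i = valency p i := by
  have hX := hG.card_ne_zero
  have h := congrFun (congrFun (distMatrix_mul_idempotent hE hP i 0) x) x
  simp only [hE.zero_eq, mul_apply, Matrix.smul_apply, of_apply, smul_eq_mul, mul_one,
    ← Finset.sum_mul] at h
  rw [← mul_right_cancel₀ (inv_ne_zero hX) h, valency,
    ← hG.card_eq 0 i i (Nat.zero_le _) (by omega) (by omega) x x (by simp)]
  simp [distMatrix]

/-- An empty sphere would force `A_i = 0`, hence a zero column in the invertible matrix `P`. -/
theorem exists_dist_eq (hG : IsDistanceRegular G D p)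
    (hE : IsPrimitiveIdempotents G D E) (hP : IsFirstEigenmatrix G E P)
    (hQ : IsSecondEigenmatrix G E Q) (x : X) (i : Fin (D + 1)) : ∃ y, G.dist x y = i := by
  by_contra! hne
  have hk : p 0 i i = 0 := by
    rw [← hG.card_eq 0 i i (Nat.zero_le _) (by omega) (by omega) x x (by simp)]
    simp [hne]
  have hA : distMatrix G i = 0 := by
    ext y z
    have h := hG.card_eq 0 i i (Nat.zero_le _) (by omega) (by omega) y y (by simp)
    rw [hk, Finset.card_eq_zero, Finset.filter_eq_empty_iff] at h
    have hz := h (Finset.mem_univ z)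
    rw [and_self] at hz
    simp [distMatrix, hz]
  have hPi : ∀ l, P l i = 0 :=
    Fintype.linearIndependent_iff.1 hE.linearIndependent (fun l => P l i) (by rw [← hP i, hA])
  have hPQ := firstEigenmatrix_mul_secondEigenmatrix hG hE hP hQ
  have hQP : Q * P = (Fintype.card X : ℂ) • 1 := by
    have hX := hG.card_ne_zero
    have h1 : P * ((Fintype.card X : ℂ)⁻¹ • Q) = 1 := by
      rw [Matrix.mul_smul, hPQ, smul_smul, inv_mul_cancel₀ hX, one_smul]
    have h2 := mul_eq_one_comm.1 h1
    rw [Matrix.smul_mul] at h2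
    rw [← h2, smul_smul, mul_inv_cancel₀ hX, one_smul]
  have h := congrFun (congrFun hQP i) i
  simp only [mul_apply, hPi, mul_zero, Finset.sum_const_zero, Matrix.smul_apply, one_apply_eq,
    smul_eq_mul, mul_one] at h
  exact hG.card_ne_zero h.symm

theorem diagonal_mul_incidence (r : X → Fin (D + 1)) (c : Fin (D + 1) → ℂ) :
    (diagonal fun y => c (r y)) * incidence r = incidence r * diagonal c := by
  ext y i
  rw [diagonal_mul, mul_diagonal]
  by_cases h : r y = i <;> simp [incidence, h]

/-- Column `l` of `incidence r * Q` is `|X|` times column `x` of `E l`, so orthogonality of the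
idempotents applies. -/
theorem idempotent_mul_incidence_mul (hG : IsDistanceRegular G D p)
    (hE : IsPrimitiveIdempotents G D E) (hQ : IsSecondEigenmatrix G E Q) {x : X}
    {r : X → Fin (D + 1)} (hr : ∀ y, (r y : ℕ) = G.dist x y) (j : Fin (D + 1)) :
    E j * (incidence r * Q) = incidence r * (Q * diagonal (Pi.single j (1 : ℂ))) := by
  ext y l
  rw [← Matrix.mul_assoc (incidence r), mul_diagonal, incidence_mul_secondEigenmatrix_apply hG hQ hr, mul_apply]
  simp only [incidence_mul_secondEigenmatrix_apply hG hQ hr]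
  have h := congrFun (congrFun (hE.mul_eq j l) y) x
  rw [mul_apply] at h
  calc ∑ z, E j y z * ((Fintype.card X : ℂ) * E l z x)
      = (Fintype.card X : ℂ) * ∑ z, E j y z * E l z x := by
        rw [Finset.mul_sum]
        exact Finset.sum_congr rfl fun _ _ => by ring
    _ = _ := by
        rw [h]
        by_cases hjl : j = l
        · subst hjl; simp
        · simp [hjl]

theorem sphereMatrix_mul_secondEigenmatrix (hG : IsDistanceRegular G D p) (hD : 1 ≤ D)
    (hE : IsPrimitiveIdempotents G D E) (hP : IsFirstEigenmatrix G E P)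
    (hQ : IsSecondEigenmatrix G E Q) {x : X}
    {r : X → Fin (D + 1)} (hr : ∀ y, (r y : ℕ) = G.dist x y) (hs : Function.Surjective r) :
    sphereMatrix D p * Q = Q * diagonal fun i => P i 1 := by
  -- The numeral `1` in `Fin (D + 1)` would wrap around to `0` if `D = 0`.
  have h1 : ((1 : Fin (D + 1)) : ℕ) = 1 := by
    rw [Fin.val_one', Nat.mod_eq_of_lt (by omega)]
  refine incidence_mul_cancel hs ?_
  rw [← Matrix.mul_assoc, ← distMatrix_one_mul_incidence hG hD hr, Matrix.mul_assoc]
  ext y j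
  have h := congrFun (congrFun (distMatrix_mul_idempotent hE hP 1 j) y) x
  rw [h1, mul_apply, Matrix.smul_apply, smul_eq_mul] at h
  rw [← Matrix.mul_assoc (incidence r), mul_diagonal, incidence_mul_secondEigenmatrix_apply hG hQ hr, mul_apply]
  simp only [incidence_mul_secondEigenmatrix_apply hG hQ hr]
  calc ∑ z, distMatrix G 1 y z * ((Fintype.card X : ℂ) * E j z x)
      = (Fintype.card X : ℂ) * ∑ z, distMatrix G 1 y z * E j z x := by
        rw [Finset.mul_sum]
        exact Finset.sum_congr rfl fun _ _ => by ring
    _ = _ := by rw [h]; ring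

/-- On the primary module the `Z`-assumption says that a diagonal matrix commutes with the
eigenmatrix, so it is scalar. -/
theorem sphereMatrix_diag_of_ZAssumption (hG : IsDistanceRegular G D p) (hD : 1 ≤ D)
    (hE : IsPrimitiveIdempotents G D E) (hP : IsFirstEigenmatrix G E P)
    (hQ : IsSecondEigenmatrix G E P) {q α ε : ℂ} {x : X}
    {r : X → Fin (D + 1)} (hr : ∀ y, (r y : ℕ) = G.dist x y) (hs : Function.Surjective r)
    (hZ : ZAssumption G E (fun i => P i 1) q α ε x) :
    ∃ f : ℂ, ∀ i, (1 + (P i 1 - ε) / α * (1 / (q + q⁻¹))) *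
      (α⁻¹ • (sphereMatrix D p - ε • 1)) i i = f := by
  set M := sphereMatrix D p with hM
  set R := incidence r with hR
  set Θ := diagonal fun i => P i 1 with hΘ
  set c : Fin (D + 1) → ℂ := fun i => 1 + (P i 1 - ε) / α * (1 / (q + q⁻¹)) with hc
  set F := diagonal fun i => c i * (α⁻¹ • (M - ε • 1)) i i with hF
  have hX := hG.card_ne_zero
  have hPP := firstEigenmatrix_mul_secondEigenmatrix hG hE hP hQ
  have hMP : M * P = P * Θ := sphereMatrix_mul_secondEigenmatrix hG hD hE hP hQ hr hs
  have hAR : distMatrix G 1 * R = R * M := distMatrix_one_mul_incidence hG hD hr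
  have hdR (i : Fin (D + 1)) : dualIdempotent G x i * R = R * diagonal (Pi.single i (1 : ℂ)) := by
    rw [hR, ← diagonal_mul_incidence, dualIdempotent]
    congr 2
    ext y
    simp [Pi.single_apply, Fin.ext_iff, hr]
  have hAsR : dualAdjMatrix E x * R = R * Θ := by
    rw [hR, hΘ, ← diagonal_mul_incidence, dualAdjMatrix]
    congr 2
    ext y
    have h := incidence_mul_secondEigenmatrix_apply hG hQ hr y 1
    rw [incidence_mul_apply] at h
    rw [h, ← congrFun (congrFun (hE.transpose_eq 1) y) x, transpose_apply]
  have hER (i : Fin (D + 1)) : E i * (R * P) = R * (P * diagonal (Pi.single i (1 : ℂ))) :=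
    idempotent_mul_incidence_mul hG hE hQ hr i
  have hsand (B : Matrix (Fin (D + 1)) (Fin (D + 1)) ℂ) (i : Fin (D + 1)) :
      diagonal (Pi.single i (1 : ℂ)) * B * diagonal (Pi.single i (1 : ℂ)) =
        B i i • diagonal (Pi.single i (1 : ℂ)) := by
    ext k l
    rw [mul_diagonal, diagonal_mul, Matrix.smul_apply, smul_eq_mul, diagonal_apply]
    by_cases hk : k = i
    · subst hk
      by_cases hl : l = k
      · subst hl; simp
      · simp [Ne.symm hl]
    · simp [Pi.single_eq_of_ne hk]
  have hFsum : ∑ i, c i • ((α⁻¹ • (M - ε • 1)) i i • diagonal (Pi.single i (1 : ℂ))) = F := by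
    ext k l
    rw [Matrix.sum_apply, hF, diagonal_apply]
    by_cases hkl : k = l
    · subst hkl
      rw [Finset.sum_eq_single k]
      · simp
      · intro b _ hb; simp [Pi.single_eq_of_ne (Ne.symm hb)]
      · simp
    · simp [hkl]
  have hL : (∑ i : Fin (D + 1), c i •
      (dualIdempotent G x i * (α⁻¹ • (distMatrix G 1 - ε • 1)) * dualIdempotent G x i)) * R =
      R * F := by
    rw [← hFsum, Matrix.sum_mul, Matrix.mul_sum]
    refine Finset.sum_congr rfl fun i _ => ?_
    have h1 : (α⁻¹ • (distMatrix G 1 - ε • 1)) * R = R * (α⁻¹ • (M - ε • 1)) := by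
      simp only [Matrix.smul_mul, Matrix.mul_smul, Matrix.sub_mul, Matrix.mul_sub, hAR,
        Matrix.one_mul, Matrix.mul_one]
    rw [← hsand]
    generalize α⁻¹ • (distMatrix G 1 - ε • 1) = B at h1 ⊢
    generalize α⁻¹ • (M - ε • 1) = N at h1 ⊢
    rw [Matrix.smul_mul, Matrix.mul_smul]
    congr 1
    rw [Matrix.mul_assoc, hdR, ← Matrix.mul_assoc (_ * B), Matrix.mul_assoc _ B, h1,
      ← Matrix.mul_assoc _ R, hdR]
    simp only [Matrix.mul_assoc]
  have hΘP : Θ * P = P * M := mul_eq_mul_of_mul_self_eq_smul_one hX hPP hMP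
  have hRt : (∑ i : Fin (D + 1), c i •
      (E i * (α⁻¹ • (dualAdjMatrix E x - ε • 1)) * E i)) * (R * P) = R * (P * F) := by
    rw [← hFsum, Matrix.sum_mul, Matrix.mul_sum, Matrix.mul_sum]
    refine Finset.sum_congr rfl fun i _ => ?_
    have h1 : (α⁻¹ • (dualAdjMatrix E x - ε • 1)) * (R * P) =
        R * P * (α⁻¹ • (M - ε • 1)) := by
      simp only [Matrix.smul_mul, Matrix.mul_smul, Matrix.sub_mul, Matrix.mul_sub,
        Matrix.one_mul, Matrix.mul_one]
      rw [← Matrix.mul_assoc, hAsR, Matrix.mul_assoc, hΘP, Matrix.mul_assoc]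
    rw [← hsand]
    generalize α⁻¹ • (dualAdjMatrix E x - ε • 1) = B at h1 ⊢
    generalize α⁻¹ • (M - ε • 1) = N at h1 ⊢
    rw [Matrix.smul_mul, Matrix.mul_smul, Matrix.mul_smul]
    congr 1
    rw [Matrix.mul_assoc, hER, ← Matrix.mul_assoc R, ← Matrix.mul_assoc (_ * B),
      Matrix.mul_assoc _ B, h1, ← Matrix.mul_assoc (E i), hER]
    simp only [Matrix.mul_assoc]
  -- The two sides of the Z-assumption act on the columns of `R * P` as `F * P` and `P * F`.
  have hFP : F * P = P * F := by
    refine incidence_mul_cancel hs ?_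
    rw [← hR, ← hRt, ← Matrix.mul_assoc, ← hL, Matrix.mul_assoc]
    exact congrArg (· * (R * P)) hZ
  refine ⟨c 0 * (α⁻¹ • (M - ε • 1)) 0 0, fun i => ?_⟩
  -- Column 0 of `P` is all ones, so this column alone forces `F` to be scalar.
  have h := congrFun (congrFun hFP i) 0
  rw [hF, diagonal_mul, mul_diagonal, firstEigenmatrix_zero_right hG hE hP, mul_one, one_mul] at h
  exact h

end Graph

end DRG

/-! ### The theorem. -/

theorem lemma13p1 {X : Type*} [Fintype X] [DecidableEq X]
    (G : SimpleGraph X) (D : ℕ) (hD : 3 ≤ D) (p : ℕ → ℕ → ℕ → ℕ)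
    (hG : DRG.IsDistanceRegular G D p)
    (E : Fin (D + 1) → Matrix X X ℂ) (hE : DRG.IsPrimitiveIdempotents G D E)
    (P Q : Matrix (Fin (D + 1)) (Fin (D + 1)) ℂ)
    (hP : DRG.IsFirstEigenmatrix G E P) (hQ : DRG.IsSecondEigenmatrix G E Q)
    (hPQ : P = Q)
    (q a α ε : ℂ) (hq : q ≠ 0) (hq1 : q ^ 2 ≠ 1) (hq2 : q ^ 2 ≠ -1)
    (ha : a ≠ 0) (hα : α ≠ 0)
    (hθ : ∀ i : Fin (D + 1), P i 1 =
      α * (a * q ^ (2 * (i : ℤ) - (D : ℤ)) + a⁻¹ * q ^ ((D : ℤ) - 2 * (i : ℤ))) + ε)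
    (x : X) (hZ : DRG.ZAssumption G E (fun i => P i 1) q α ε x) :
    (Fintype.card X : ℂ) =
        (∑ i ∈ Finset.range (D + 1), DRG.tau D a q i * (DRG.valency p i : ℂ)) *
          (∑ i ∈ Finset.range (D + 1), (DRG.tau D a q i)⁻¹ * (DRG.valency p i : ℂ)) ∧
      (∑ i ∈ Finset.range (D + 1), DRG.tau D a q i * (DRG.valency p i : ℂ)) ≠ 0 ∧
      (∑ i ∈ Finset.range (D + 1), (DRG.tau D a q i)⁻¹ * (DRG.valency p i : ℂ)) ≠ 0 := by
  subst hPQ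
  have hD1 : 1 ≤ D := by omega
  have hX := hG.card_ne_zero
  have hx := DRG.exists_dist_eq hG hE hP hQ x
  let r : X → Fin (D + 1) := fun y => ⟨G.dist x y, Nat.lt_succ_of_le (hG.dist_le x y)⟩
  have hr : ∀ y, (r y : ℕ) = G.dist x y := fun _ => rfl
  have hs : Function.Surjective r := fun i => (hx i).imp fun _ h => Fin.ext h
  have hPP := DRG.firstEigenmatrix_mul_secondEigenmatrix hG hE hP hQ
  have hMP := DRG.sphereMatrix_mul_secondEigenmatrix hG hD1 hE hP hQ hr hs
  have hP0 := DRG.firstEigenmatrix_zero_right hG hE hP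
  have hk := DRG.firstEigenmatrix_zero_left hG hE hP x
  obtain ⟨f, hf⟩ := DRG.sphereMatrix_diag_of_ZAssumption hG hD1 hE hP hQ hr hs hZ
  have hθ' : ∀ i, (P i 1 - ε) / α = DRG.racahEigenvalue D a q i := fun i => by
    rw [hθ, add_sub_cancel_right, mul_div_cancel_left₀ _ hα, DRG.racahEigenvalue]
  simp only [hθ'] at hf
  -- Column 0 of `M P = P Θ` is the row-sum statement, with row sum `θ_0`.
  have hrow : ∀ i, ∑ j, DRG.sphereMatrix D p i j = P 0 1 := fun i => by
    have h := congrFun (congrFun hMP i) 0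
    rw [mul_diagonal, hP0, one_mul, mul_apply] at h
    simpa only [hP0, mul_one] using h
  have hΘ : (diagonal fun i : Fin (D + 1) => DRG.racahEigenvalue D a q i) =
      α⁻¹ • ((diagonal fun i => P i 1) - ε • 1) := by
    ext i j
    by_cases hij : i = j
    · subst hij
      simp [← hθ', div_eq_inv_mul]
    · simp [hij]
  have h1 : α⁻¹ • (DRG.sphereMatrix D p - ε • 1) * P =
      P * diagonal fun i : Fin (D + 1) => DRG.racahEigenvalue D a q i := by
    rw [hΘ]
    simp only [Matrix.smul_mul, Matrix.mul_smul, Matrix.sub_mul, Matrix.mul_sub, Matrix.one_mul,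
      Matrix.mul_one, hMP]
  have h2 := DRG.mul_eq_mul_of_mul_self_eq_smul_one hX hPP h1
  obtain ⟨s, hs'⟩ := DRG.exists_mulVec_tau_eq ha hq hq1 hq2 hα
    (DRG.sphereMatrix_tridiagonal hG hD1 hx) (DRG.sphereMatrix_superdiagonal_ne_zero hG hD1 hx)
    hrow hf h1 h2
  have e1 : ∑ i ∈ Finset.range (D + 1), DRG.tau D a q i * (DRG.valency p i : ℂ) = s := by
    have h := hs' 0
    rw [Fin.val_zero, DRG.tau_zero, inv_one, mul_one] at h
    rw [← h, Finset.sum_range]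
    simp only [mulVec, dotProduct, hk, mul_comm]
  have e2 : s * ∑ i ∈ Finset.range (D + 1), (DRG.tau D a q i)⁻¹ * (DRG.valency p i : ℂ) =
      Fintype.card X := by
    -- `P² = |X| I` is read at entry 0, where `τ_0 = 1`.
    have h : (P *ᵥ (P *ᵥ fun j : Fin (D + 1) => DRG.tau D a q j)) 0 = Fintype.card X := by
      rw [mulVec_mulVec, hPP, smul_mulVec, one_mulVec, Pi.smul_apply, Fin.val_zero, DRG.tau_zero,
        smul_eq_mul, mul_one]
    rw [← h, funext hs', Finset.sum_range, Finset.mul_sum]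
    simp only [mulVec, dotProduct, hk]
    exact Finset.sum_congr rfl fun _ _ => by ring
  rw [e1]
  exact ⟨e2.symm, left_ne_zero_of_mul (e2 ▸ hX), right_ne_zero_of_mul (e2 ▸ hX)⟩
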